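/- For $c\in\{0,1\}^n$ let $f_c:\mathbb{R}^n\to\mathbb{R}$ be $$f_c(x)=\max_{1\le i\le n}|\pi(x_i)-c_i|+\sum_{i=1}^n|\pi(x_i)-x_i|,$$ where $\pi:\mathbb{R}\to[0,1]$ is the projection ($\pi(t)=0$ for $t<0$, $\pi(t)=t$ for $0\le t\le 1$, $\pi(t)=1$ for $t>1$). In the max-norm optimization problem the string $c$ is unknown and $f_c$ is accessible only through an evaluation oracle. For $0<\delta<0.05$, an evaluation oracle with precision $\delta$ provides $f_c$ with $b=\lceil\log_2(1/\delta)\rceil$ bits of precision: it is the unitary $O:|x\rangle|a\rangle\mapsto|x\rangle|a+\rho(f_c(x))\rangle$ (so $O|x,0\rangle=|x,\rho(f_c(x))\rangle$), where $\rho:\mathbb{R}\to 2^{-b}\mathbb{Z}$ is a fixed monotone rounding map with $|\rho(t)-t|\le\delta$ for all $t$ (for example rounding down, or rounding to a nearest grid point). Then there is an absolute constant $K>0$ such that for all $n\ge 1$, all $0<\delta<0.05$ and every such $\rho$ the following holds. Let a quantum query algorithm, which may depend on $n$, $\delta$ and $\rho$ but not on $c$, make $T$ queries to the oracle (forward, inverse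 or controlled), with arbitrary unitaries that do not depend on the oracle in between and an arbitrary workspace. If for every $c\in\{0,1\}^n$ it outputs, with probability at least $0.9$, a point $\tilde x\in[0,1]^n$ such that $$f_c(\tilde x)\le\min_{x\in[0,1]^n}f_c(x)+\tfrac13,$$ then $$T\ge K\,\frac{\sqrt n}{\log(1/\delta)}.$$ That is, $\Omega(\sqrt n/\log(1/\delta))$ quantum queries are needed. -/

import Mathlib

noncomputable section

namespace MaxNormQuery

/-! ### The max-norm optimization problem -/

/-- The projection of a real number onto `[0, 1]`. -/
def proj (t : ℝ) : ℝ := if t < 0 then 0 else if t ≤ 1 then t else 1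

/-- A bit as a real number. -/
def bit (b : Bool) : ℝ := if b then 1 else 0

/-- The objective `f_c(x) = max_i |π(x_i) - c_i| + ∑_i |π(x_i) - x_i|` on `ℝⁿ`
(the supremum is a maximum over the finite index set). -/
def objective {n : ℕ} (c : Fin n → Bool) (x : Fin n → ℝ) : ℝ :=
  (⨆ i, |proj (x i) - bit (c i)|) + ∑ i, |proj (x i) - x i|

/-- The unit hypercube `[0, 1]ⁿ`. -/
def cube (n : ℕ) : Set (Fin n → ℝ) := {x | ∀ i, 0 ≤ x i ∧ x i ≤ 1}

/-- `x` lies in `[0, 1]ⁿ` and `f_c(x) ≤ min_{y ∈ [0, 1]ⁿ} f_c(y) + ε`. -/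
def IsApproxMinimizer {n : ℕ} (c : Fin n → Bool) (ε : ℝ) (x : Fin n → ℝ) : Prop :=
  x ∈ cube n ∧ ∀ y ∈ cube n, objective c x ≤ objective c y + ε

/-- The number of bits `⌈log₂ (1 / δ)⌉` that goes with precision `δ`. -/
def precisionBits (δ : ℝ) : ℕ := ⌈Real.logb 2 (1 / δ)⌉₊

/-- `ρ` rounds real numbers with precision `δ`: it is monotone, its values have
`⌈log₂ (1 / δ)⌉` binary digits after the point, and it moves no number by more than `δ`.
Rounding down, up, or to a nearest grid point are examples. -/
structure IsRounding (δ : ℝ) (ρ : ℝ → ℝ) : Prop where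
  monotone : Monotone ρ
  bits : ∀ t, ∃ k : ℤ, ρ t = (k : ℝ) / 2 ^ precisionBits δ
  error : ∀ t, |ρ t - t| ≤ δ

/-- Rounding down is a rounding with precision `δ`. -/
theorem isRounding_floor {δ : ℝ} (hδ : 0 < δ) :
    IsRounding δ (fun t => (⌊t * 2 ^ precisionBits δ⌋ : ℝ) / 2 ^ precisionBits δ) := by
  have hp : (0 : ℝ) < 2 ^ precisionBits δ := by positivity
  have hb : 1 / δ ≤ (2 : ℝ) ^ precisionBits δ := by
    have h1 : Real.logb 2 (1 / δ) ≤ (precisionBits δ : ℝ) := Nat.le_ceil _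
    rw [Real.logb_le_iff_le_rpow (by norm_num) (by positivity)] at h1
    simpa using h1
  refine ⟨fun s t h => ?_, fun t => ⟨_, rfl⟩, fun t => ?_⟩
  · gcongr
  · have h1 := Int.floor_le (t * 2 ^ precisionBits δ)
    have h2 := (Int.lt_floor_add_one (t * 2 ^ precisionBits δ)).le
    have h3 : 1 / (2 : ℝ) ^ precisionBits δ ≤ δ := by
      rw [div_le_iff₀ hδ] at hb
      rw [div_le_iff₀ hp]
      linarith
    rw [← le_div_iff₀ hp, add_div] at h2
    rw [← div_le_iff₀ hp] at h1
    rw [abs_le]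
    constructor <;> linarith

/-! ### Quantum query algorithms -/

/-- The computational basis states: a query point, an answer register, a workspace basis state,
and a control register `mode`, which says whether the next query acts as the oracle
(`1`), as its inverse (`-1`), or not at all (`0`). -/
@[ext]
structure Ket (n : ℕ) (W : Type*) where
  mode : SignType
  point : Fin n → ℝ
  answer : ℝ
  work : W

/-- The Hilbert space `ℓ²` with the computational basis as orthonormal basis. -/
abbrev State (n : ℕ) (W : Type*) := lp (fun _ : Ket n W => ℂ) 2

/-- The basis permutation `(m, x, a, w) ↦ (m, x, a + m F(x), w)`. -/
def queryPerm {n : ℕ} {W : Type*} (F : (Fin n → ℝ) → ℝ) : Ket n W ≃ Ket n W where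
  toFun z := ⟨z.mode, z.point, z.answer + (z.mode : ℝ) * F z.point, z.work⟩
  invFun z := ⟨z.mode, z.point, z.answer - (z.mode : ℝ) * F z.point, z.work⟩
  left_inv z := by ext <;> simp
  right_inv z := by ext <;> simp

theorem memℓp_comp_equiv {ι : Type*} (e : ι ≃ ι) (ψ : lp (fun _ : ι => ℂ) 2) :
    Memℓp (fun z => ψ (e z)) 2 := by
  have h := lp.memℓp ψ
  rw [memℓp_gen_iff (by norm_num)] at h ⊢
  exact e.summable_iff.2 h

/-- The unitary operator that permutes the basis of `ℓ²(ι)` by `e`. -/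
def permute {ι : Type*} (e : ι ≃ ι) :
    lp (fun _ : ι => ℂ) 2 ≃ₗᵢ[ℂ] lp (fun _ : ι => ℂ) 2 where
  toFun ψ := ⟨fun z => ψ (e.symm z), memℓp_comp_equiv e.symm ψ⟩
  invFun ψ := ⟨fun z => ψ (e z), memℓp_comp_equiv e ψ⟩
  map_add' _ _ := rfl
  map_smul' _ _ := rfl
  left_inv ψ := by
    ext z
    simp
  right_inv ψ := by
    ext z
    simp
  norm_map' ψ := by
    simp only [lp.norm_eq_tsum_rpow (p := 2) (by norm_num)]
    congr 1
    exact e.symm.tsum_eq (fun z => ‖ψ z‖ ^ (2 : ENNReal).toReal)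

/-- The evaluation oracle `O_F`, a unitary operator. -/
def oracle {n : ℕ} {W : Type*} (F : (Fin n → ℝ) → ℝ) : State n W ≃ₗᵢ[ℂ] State n W :=
  permute (queryPerm F)

open Classical in
/-- `O_F |x, 0⟩ = |x, F(x)⟩`. -/
theorem oracle_single {n : ℕ} {W : Type*} (F : (Fin n → ℝ) → ℝ) (x : Fin n → ℝ) (w : W) :
    oracle F (lp.single 2 (⟨1, x, 0, w⟩ : Ket n W) (1 : ℂ))
      = lp.single 2 (⟨1, x, F x, w⟩ : Ket n W) (1 : ℂ) := by
  have key : ∀ z : Ket n W,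
      (queryPerm F).symm z = ⟨1, x, 0, w⟩ ↔ z = (⟨1, x, F x, w⟩ : Ket n W) := by
    intro z
    rw [Equiv.symm_apply_eq]
    simp [queryPerm]
  ext z
  change (lp.single 2 (⟨1, x, 0, w⟩ : Ket n W) (1 : ℂ) : Ket n W → ℂ) ((queryPerm F).symm z) = _
  simp only [lp.single_apply, Pi.single_apply, key]

/-- A quantum query algorithm on `ℝⁿ` with workspace basis `W`: it starts in the unit vector
`init`, makes `queries` oracle queries, applies after the `k`-th one (counted from `0`) the
unitary operator `gate k`, measures in the computational basis, and computes its output point from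
the measured basis state. Nothing in it depends on the oracle. -/
structure QueryAlgorithm (n : ℕ) (W : Type*) where
  queries : ℕ
  init : State n W
  norm_init : ‖init‖ = 1
  gate : ℕ → (State n W ≃ₗᵢ[ℂ] State n W)
  output : Ket n W → (Fin n → ℝ)

namespace QueryAlgorithm

variable {n : ℕ} {W : Type*}

/-- The state after `k` queries to the oracle for `F`. -/
def stateAfter (A : QueryAlgorithm n W) (F : (Fin n → ℝ) → ℝ) : ℕ → State n W
  | 0 => A.init
  | k + 1 => A.gate k (oracle F (A.stateAfter F k))

open Classical in
/-- The probability that the output of `A`, run with the oracle for `F`, satisfies `P`. -/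
def outputProb (A : QueryAlgorithm n W) (F : (Fin n → ℝ) → ℝ) (P : (Fin n → ℝ) → Prop) : ℝ :=
  ∑' z : Ket n W, if P (A.output z) then ‖A.stateAfter F A.queries z‖ ^ 2 else 0

end QueryAlgorithm

end MaxNormQuery

end

namespace MaxNormQuery

/-! ### Edges of the Boolean cube -/

/-! This is a quantum adversary argument on the edges of the Boolean cube. The progress measure is
`edgeOverlap`, the sum over directed edges of the overlaps of the algorithm's states. Before any
query it is `n * 2 ^ n`. At the end it is at most `3 / 5` of that, since neighbouring strings share
no approximate minimizer (`not_isApproxMinimizer_flipBit`, `norm_inner_le_of_distinguished`). One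
query moves it by at most `4 * √n * 2 ^ n`. At a fixed query point, only edges along which the value
changes matter. Oriented upwards, they have in-degree at most 1 (`eq_of_objective_flipBit_lt`) and
out-degree at most `n`, hence norm at most `√n` (`sum_increasing_edges_le`). Monotone rounding
preserves this. So `√n / 10` queries are needed at any precision, and `1 ≤ log (1 / δ)` gives the
stated form. -/

/-- Flip the `i`-th bit of a string. -/
def flipBit {n : ℕ} (i : Fin n) (c : Fin n → Bool) : Fin n → Bool :=
  Function.update c i (!c i)

theorem flipBit_involutive {n : ℕ} (i : Fin n) : Function.Involutive (flipBit i) := by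
  intro c
  simp [flipBit]

theorem sum_flipBit {n : ℕ} (i : Fin n) (f : (Fin n → Bool) → ℝ) :
    ∑ c, f (flipBit i c) = ∑ c, f c :=
  Equiv.sum_comp (flipBit_involutive i).toPerm f

open Classical in
/-- If no string has two neighbours of smaller value, then the directed graph of the edges of the
cube along which the value increases has spectral norm at most `√n`. -/
theorem sum_increasing_edges_le {n : ℕ} (hn : 1 ≤ n) (G : (Fin n → Bool) → ℝ)
    (hG : ∀ c i j, G (flipBit i c) < G c → G (flipBit j c) < G c → i = j)
    (a : (Fin n → Bool) → ℝ) :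
    ∑ c, ∑ i, (if G c < G (flipBit i c) then a c * a (flipBit i c) else 0)
      ≤ √n * ∑ c, a c ^ 2 := by
  have hs : 0 < √(n : ℝ) := Real.sqrt_pos.2 (by exact_mod_cast hn)
  have hss : √(n : ℝ) * √n = n := Real.mul_self_sqrt (by positivity)
  -- AM-GM, weighted so that `n` outgoing edges and one incoming edge cost the same in total.
  have h1 : ∀ c i, (if G c < G (flipBit i c) then a c * a (flipBit i c) else 0)
      ≤ a c ^ 2 / (2 * √n)
        + √n / 2 * (if G c < G (flipBit i c) then a (flipBit i c) ^ 2 else 0) := by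
    intro c i
    split_ifs
    · have h := sq_nonneg (a c - √n * a (flipBit i c))
      rw [div_add' _ _ _ (by positivity), le_div_iff₀ (by positivity)]
      nlinarith
    · positivity
  have h2 : ∑ c, ∑ i, (if G c < G (flipBit i c) then a (flipBit i c) ^ 2 else 0)
      ≤ ∑ c, a c ^ 2 := by
    rw [Finset.sum_comm]
    have : ∀ i, ∑ c, (if G c < G (flipBit i c) then a (flipBit i c) ^ 2 else 0)
        = ∑ c, (if G (flipBit i c) < G c then a c ^ 2 else 0) := by
      intro i
      rw [← sum_flipBit i]
      simp only [flipBit_involutive i _]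
    simp only [this]
    rw [Finset.sum_comm]
    refine Finset.sum_le_sum fun c _ => ?_
    by_cases h : ∃ i, G (flipBit i c) < G c
    · obtain ⟨i, hi⟩ := h
      rw [Finset.sum_eq_single i]
      · simp [hi]
      · intro j _ hj
        rw [if_neg fun hj' => hj (hG c j i hj' hi)]
      · simp
    · push Not at h
      simp only [not_lt.2 (h _), if_false, Finset.sum_const_zero]
      positivity
  calc _ ≤ ∑ c, ∑ i : Fin n, (a c ^ 2 / (2 * √n)
        + √n / 2 * (if G c < G (flipBit i c) then a (flipBit i c) ^ 2 else 0)) :=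
        Finset.sum_le_sum fun c _ => Finset.sum_le_sum fun i _ => h1 c i
    _ = √n / 2 * ∑ c, a c ^ 2
        + √n / 2 * ∑ c, ∑ i, (if G c < G (flipBit i c) then a (flipBit i c) ^ 2 else 0) := by
        simp only [Finset.sum_add_distrib, Finset.sum_const, Finset.card_univ, Fintype.card_fin,
          nsmul_eq_mul, ← Finset.mul_sum, ← Finset.sum_div]
        congr 1
        rw [mul_div_assoc', div_eq_iff (by positivity)]
        linear_combination (-∑ c, a c ^ 2) * hss
    _ ≤ √n / 2 * ∑ c, a c ^ 2 + √n / 2 * ∑ c, a c ^ 2 := by gcongr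
    _ = _ := by ring

-- Each differing edge increases in exactly one direction, and reversing edges swaps the two cases.
open Classical in
theorem sum_differing_edges_le {n : ℕ} (hn : 1 ≤ n) (G : (Fin n → Bool) → ℝ)
    (hG : ∀ c i j, G (flipBit i c) < G c → G (flipBit j c) < G c → i = j)
    (a : (Fin n → Bool) → ℝ) :
    ∑ c, ∑ i, (if G c ≠ G (flipBit i c) then a c * a (flipBit i c) else 0)
      ≤ 2 * √n * ∑ c, a c ^ 2 := by
  have h := sum_increasing_edges_le hn G hG a
  have h1 : ∀ c i, (if G c ≠ G (flipBit i c) then a c * a (flipBit i c) else 0)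
      = (if G c < G (flipBit i c) then a c * a (flipBit i c) else 0)
        + (if G (flipBit i c) < G c then a c * a (flipBit i c) else 0) := by
    intro c i
    rcases lt_trichotomy (G c) (G (flipBit i c)) with h | h | h
    · simp [h, h.ne, h.le]
    · simp [h]
    · simp [h, h.ne', h.le]
  have h2 : ∑ c, ∑ i, (if G (flipBit i c) < G c then a c * a (flipBit i c) else 0)
      = ∑ c, ∑ i, (if G c < G (flipBit i c) then a c * a (flipBit i c) else 0) := by
    rw [Finset.sum_comm, Finset.sum_comm (s := Finset.univ (α := Fin n → Bool))]
    refine Finset.sum_congr rfl fun i _ => ?_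
    rw [← sum_flipBit i]
    simp only [flipBit_involutive i _, mul_comm]
  simp only [h1, Finset.sum_add_distrib]
  rw [h2]
  linarith

/-! ### The objective function -/

/-- Only one flip, that of the unique coordinate attaining the maximum, can lower the objective. -/
theorem eq_of_objective_flipBit_lt {n : ℕ} (x : Fin n → ℝ) (c : Fin n → Bool) (i j : Fin n)
    (hi : objective (flipBit i c) x < objective c x)
    (hj : objective (flipBit j c) x < objective c x) : i = j := by
  by_contra hij
  have : Nonempty (Fin n) := ⟨i⟩
  unfold objective at hi hj
  rw [add_lt_add_iff_right] at hi hj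
  -- Flipping a bit other than `k` keeps the term at `k`, so the maximum cannot drop.
  obtain ⟨k, hk⟩ := exists_eq_ciSup_of_finite (f := fun k => |proj (x k) - bit (c k)|)
  have key : ∀ l, k ≠ l → ¬ (⨆ m, |proj (x m) - bit (flipBit l c m)|)
      < ⨆ m, |proj (x m) - bit (c m)| := by
    intro l hl
    rw [not_lt, ← hk]
    refine le_trans (le_of_eq ?_)
      (le_ciSup (f := fun m => |proj (x m) - bit (flipBit l c m)|) (Set.finite_range _).bddAbove k)
    simp [flipBit, hl]
  have h1 : k = i := by
    by_contra h
    exact key i h hi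
  have h2 : k = j := by
    by_contra h
    exact key j h hj
  exact hij (h1.symm.trans h2)

/-- On the cube the penalty vanishes and the objective is the max-norm distance to `c`, with minimum
`0` at `c`. -/
theorem abs_sub_bit_le_of_isApproxMinimizer {n : ℕ} {c : Fin n → Bool} {ε : ℝ} {x : Fin n → ℝ}
    (h : IsApproxMinimizer c ε x) (i : Fin n) : |x i - bit (c i)| ≤ ε := by
  have : Nonempty (Fin n) := ⟨i⟩
  have hp : ∀ t : ℝ, 0 ≤ t ∧ t ≤ 1 → proj t = t := by
    intro t ht
    simp [proj, not_lt.2 ht.1, ht.2]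
  have hb : ∀ j, 0 ≤ bit (c j) ∧ bit (c j) ≤ 1 := by
    intro j
    unfold bit
    split_ifs <;> norm_num
  have h0 : objective c (fun j => bit (c j)) = 0 := by
    simp [objective, hp _ (hb _)]
  have h1 := h.2 (fun j => bit (c j)) hb
  rw [h0, zero_add] at h1
  have h2 : objective c x = ⨆ j, |x j - bit (c j)| := by
    simp [objective, hp _ (h.1 _)]
  rw [h2] at h1
  exact (le_ciSup (f := fun m => |x m - bit (c m)|) (Set.finite_range _).bddAbove i).trans h1

/-- Neighbouring strings have no common approximate minimizer. -/
theorem not_isApproxMinimizer_flipBit {n : ℕ} {c : Fin n → Bool} {i : Fin n} {x : Fin n → ℝ}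
    (h : IsApproxMinimizer c (1 / 3) x) : ¬ IsApproxMinimizer (flipBit i c) (1 / 3) x := by
  intro h'
  have h1 := abs_sub_bit_le_of_isApproxMinimizer h i
  have h2 := abs_sub_bit_le_of_isApproxMinimizer h' i
  rw [abs_le] at h1 h2
  cases hc : c i <;> simp [flipBit, bit, hc] at h1 h2 <;> linarith

/-! ### Inner products in `ℓ²` -/

section Hilbert

variable {ι : Type*}

theorem summable_norm_sq (ψ : lp (fun _ : ι => ℂ) 2) : Summable fun z => ‖ψ z‖ ^ 2 := by
  have h := lp.memℓp ψ
  rw [memℓp_gen_iff (by norm_num)] at h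
  simpa using h

theorem tsum_norm_sq (ψ : lp (fun _ : ι => ℂ) 2) : ∑' z, ‖ψ z‖ ^ 2 = ‖ψ‖ ^ 2 := by
  have h := lp.norm_rpow_eq_tsum (p := 2) (by norm_num) ψ
  simpa using h.symm

theorem summable_norm_mul_norm (ψ φ : lp (fun _ : ι => ℂ) 2) :
    Summable fun z => ‖ψ z‖ * ‖φ z‖ := by
  refine Summable.of_nonneg_of_le (fun z => by positivity) (fun z => ?_)
    ((summable_norm_sq ψ).add (summable_norm_sq φ))
  nlinarith [sq_nonneg (‖ψ z‖ - ‖φ z‖), sq_nonneg ‖ψ z‖, sq_nonneg ‖φ z‖]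

theorem summable_ite_norm_mul_norm (p : ι → Prop) [DecidablePred p]
    (ψ φ : lp (fun _ : ι => ℂ) 2) :
    Summable fun z => if p z then ‖ψ z‖ * ‖φ z‖ else 0 := by
  refine Summable.of_nonneg_of_le (fun z => ?_) (fun z => ?_) (summable_norm_mul_norm ψ φ)
  · split_ifs <;> positivity
  · split_ifs
    · exact le_rfl
    · positivity

theorem norm_inner_le_tsum (ψ φ : lp (fun _ : ι => ℂ) 2) :
    ‖inner ℂ ψ φ‖ ≤ ∑' z, ‖ψ z‖ * ‖φ z‖ := by
  rw [lp.inner_eq_tsum]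
  refine tsum_of_norm_bounded (summable_norm_mul_norm ψ φ).hasSum fun z => ?_
  exact norm_inner_le_norm _ _

open Classical in
theorem summable_ite_norm_sq (p : ι → Prop) (ψ : lp (fun _ : ι => ℂ) 2) :
    Summable fun z => if p z then ‖ψ z‖ ^ 2 else 0 := by
  simpa only [pow_two] using summable_ite_norm_mul_norm p ψ ψ

open Classical in
/-- Unit vectors that a measurement tells apart with error `1 / 10` have small overlap. -/
theorem norm_inner_le_of_distinguished (p q : ι → Prop) (hpq : ∀ z, p z → ¬ q z)
    (ψ φ : lp (fun _ : ι => ℂ) 2) (hψ : ‖ψ‖ = 1) (hφ : ‖φ‖ = 1)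
    (hp : 0.9 ≤ ∑' z, if p z then ‖ψ z‖ ^ 2 else 0)
    (hq : 0.9 ≤ ∑' z, if q z then ‖φ z‖ ^ 2 else 0) :
    ‖inner ℂ ψ φ‖ ≤ 3 / 5 := by
  have s1 := summable_ite_norm_sq p ψ
  have s2 := summable_ite_norm_sq q φ
  have s3 := summable_norm_sq ψ
  have s4 := summable_norm_sq φ
  have t3 := tsum_norm_sq ψ
  have t4 := tsum_norm_sq φ
  rw [hψ] at t3
  rw [hφ] at t4
  have hs := ((s3.mul_left (3 / 2)).sub (s1.mul_left (4 / 3))).add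
    ((s4.mul_left (3 / 2)).sub (s2.mul_left (4 / 3)))
  -- Off `p` or off `q` this follows from `ab ≤ a² / 6 + 3b² / 2` or its mirror image. Summed, the
  -- right side is at most `3 - 4 / 3 * 1.8 = 3 / 5`.
  have hle : ∑' z, ‖ψ z‖ * ‖φ z‖ ≤ ∑' z,
      ((3 / 2 * ‖ψ z‖ ^ 2 - 4 / 3 * (if p z then ‖ψ z‖ ^ 2 else 0))
        + (3 / 2 * ‖φ z‖ ^ 2 - 4 / 3 * (if q z then ‖φ z‖ ^ 2 else 0))) := by
    refine (summable_norm_mul_norm ψ φ).tsum_le_tsum (fun z => ?_) hs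
    have h1 := sq_nonneg (‖ψ z‖ - 3 * ‖φ z‖)
    have h2 := sq_nonneg (3 * ‖ψ z‖ - ‖φ z‖)
    have h3 := sq_nonneg (‖ψ z‖ - ‖φ z‖)
    by_cases hpz : p z
    · simp only [hpz, hpq z hpz, if_true, if_false]
      nlinarith
    · by_cases hqz : q z
      · simp only [hpz, hqz, if_true, if_false]
        nlinarith
      · simp only [hpz, hqz, if_false]
        nlinarith [sq_nonneg ‖ψ z‖, sq_nonneg ‖φ z‖]
  rw [((s3.mul_left (3 / 2)).sub (s1.mul_left (4 / 3))).tsum_add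
    ((s4.mul_left (3 / 2)).sub (s2.mul_left (4 / 3))),
    (s3.mul_left (3 / 2)).tsum_sub (s1.mul_left (4 / 3)),
    (s4.mul_left (3 / 2)).tsum_sub (s2.mul_left (4 / 3)),
    tsum_mul_left, tsum_mul_left, tsum_mul_left, tsum_mul_left, t3, t4] at hle
  have := norm_inner_le_tsum ψ φ
  linarith

end Hilbert

/-! ### The effect of a query on an inner product -/

section Oracle

variable {n : ℕ} {W : Type*}

theorem oracle_apply (F : (Fin n → ℝ) → ℝ) (ψ : State n W) (z : Ket n W) :
    oracle F ψ z = ψ ((queryPerm F).symm z) := rfl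

theorem queryPerm_symm_congr {F F' : (Fin n → ℝ) → ℝ} {z : Ket n W}
    (h : F z.point = F' z.point) : (queryPerm F).symm z = (queryPerm F').symm z := by
  simp [queryPerm, h]

open Classical in
/-- A query changes an inner product only through the points at which the oracles differ. -/
theorem norm_inner_oracle_sub_le (F F' : (Fin n → ℝ) → ℝ) (ψ φ : State n W) :
    ‖inner ℂ (oracle F ψ) (oracle F' φ) - inner ℂ ψ φ‖
      ≤ (∑' z, if F z.point ≠ F' z.point then ‖oracle F ψ z‖ * ‖oracle F' φ z‖ else 0)
        + ∑' z, if F z.point ≠ F' z.point then ‖ψ z‖ * ‖φ z‖ else 0 := by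
  -- The query permutation fixes the point, so reindexing by it preserves the condition.
  have h0 : (∑' z : Ket n W, if F z.point ≠ F' z.point then ‖ψ z‖ * ‖φ z‖ else 0)
      = ∑' z : Ket n W, if F z.point ≠ F' z.point then ‖oracle F ψ z‖ * ‖oracle F φ z‖ else 0 :=
    ((queryPerm F).symm.tsum_eq
      fun z : Ket n W => if F z.point ≠ F' z.point then ‖ψ z‖ * ‖φ z‖ else 0).symm
  have s1 := summable_ite_norm_mul_norm (fun z : Ket n W => F z.point ≠ F' z.point)
    (oracle F ψ) (oracle F' φ)
  have s2 := summable_ite_norm_mul_norm (fun z : Ket n W => F z.point ≠ F' z.point)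
    (oracle F ψ) (oracle F φ)
  rw [h0, ← s1.tsum_add s2, ← (oracle F).inner_map_map ψ φ, ← inner_sub_right, lp.inner_eq_tsum]
  refine tsum_of_norm_bounded (s1.add s2).hasSum fun z => ?_
  refine (norm_inner_le_norm _ _).trans ?_
  rw [lp.coeFn_sub, Pi.sub_apply]
  split_ifs with h
  · rw [← mul_add]
    exact mul_le_mul_of_nonneg_left (norm_sub_le _ _) (norm_nonneg _)
  · push Not at h
    simp [oracle_apply, queryPerm_symm_congr h]

end Oracle

/-! ### The progress measure -/

section Progress

variable {n : ℕ} {W : Type*}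

/-- The sum of the overlaps of a family of states over the edges of the Boolean cube. -/
noncomputable def edgeOverlap (ψ : (Fin n → Bool) → State n W) : ℂ :=
  ∑ c, ∑ i, inner ℂ (ψ c) (ψ (flipBit i c))

-- A basis state fixes one query point, so the edge bound applies to each `z` separately, with
-- weights `‖ψ c z‖`.
open Classical in
theorem sum_tsum_differing_le (hn : 1 ≤ n) (F : (Fin n → Bool) → (Fin n → ℝ) → ℝ)
    (hF : ∀ x c i j, F (flipBit i c) x < F c x → F (flipBit j c) x < F c x → i = j)
    (ψ : (Fin n → Bool) → State n W) (hψ : ∀ c, ‖ψ c‖ = 1) :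
    ∑ c, ∑ i, (∑' z, if F c z.point ≠ F (flipBit i c) z.point
        then ‖ψ c z‖ * ‖ψ (flipBit i c) z‖ else 0) ≤ 2 * √n * 2 ^ n := by
  have s : ∀ c i, Summable fun z : Ket n W => if F c z.point ≠ F (flipBit i c) z.point
      then ‖ψ c z‖ * ‖ψ (flipBit i c) z‖ else 0 := fun c i => summable_ite_norm_mul_norm _ _ _
  have s' : ∀ c ∈ (Finset.univ : Finset (Fin n → Bool)), Summable fun z : Ket n W =>
      ∑ i, if F c z.point ≠ F (flipBit i c) z.point
      then ‖ψ c z‖ * ‖ψ (flipBit i c) z‖ else 0 := fun c _ => summable_sum fun i _ => s c i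
  have t : ∀ c ∈ (Finset.univ : Finset (Fin n → Bool)),
      Summable fun z : Ket n W => ‖ψ c z‖ ^ 2 := fun c _ => summable_norm_sq (ψ c)
  have h1 : ∑ c, ∑ i, (∑' z, if F c z.point ≠ F (flipBit i c) z.point
        then ‖ψ c z‖ * ‖ψ (flipBit i c) z‖ else 0)
      = ∑' z, ∑ c, ∑ i, if F c z.point ≠ F (flipBit i c) z.point
        then ‖ψ c z‖ * ‖ψ (flipBit i c) z‖ else 0 := by
    rw [Summable.tsum_finsetSum s']
    exact Finset.sum_congr rfl fun c _ => (Summable.tsum_finsetSum fun i _ => s c i).symm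
  have h2 : ∑' z : Ket n W, 2 * √n * ∑ c, ‖ψ c z‖ ^ 2 = 2 * √n * 2 ^ n := by
    rw [tsum_mul_left, Summable.tsum_finsetSum t]
    simp [tsum_norm_sq, hψ]
  rw [h1, ← h2]
  exact (summable_sum s').tsum_le_tsum
    (fun z => sum_differing_edges_le hn (fun c => F c z.point) (hF z.point) fun c => ‖ψ c z‖)
    ((summable_sum t).mul_left _)

theorem norm_edgeOverlap_oracle_sub_le (hn : 1 ≤ n) (F : (Fin n → Bool) → (Fin n → ℝ) → ℝ)
    (hF : ∀ x c i j, F (flipBit i c) x < F c x → F (flipBit j c) x < F c x → i = j)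
    (ψ : (Fin n → Bool) → State n W) (hψ : ∀ c, ‖ψ c‖ = 1) :
    ‖edgeOverlap (fun c => oracle (F c) (ψ c)) - edgeOverlap ψ‖ ≤ 4 * √n * 2 ^ n := by
  classical
  have h1 := sum_tsum_differing_le hn F hF ψ hψ
  have h2 := sum_tsum_differing_le hn F hF (fun c => oracle (F c) (ψ c)) (by simpa using hψ)
  simp only [edgeOverlap, ← Finset.sum_sub_distrib]
  refine (norm_sum_le _ _).trans ((Finset.sum_le_sum fun c _ => (norm_sum_le _ _).trans
    (Finset.sum_le_sum fun i _ =>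
      norm_inner_oracle_sub_le (F c) (F (flipBit i c)) (ψ c) (ψ (flipBit i c)))).trans ?_)
  simp only [Finset.sum_add_distrib]
  linarith

theorem norm_stateAfter (A : QueryAlgorithm n W) (F : (Fin n → ℝ) → ℝ) (k : ℕ) :
    ‖A.stateAfter F k‖ = 1 := by
  induction k with
  | zero => exact A.norm_init
  | succ k ih => simp [QueryAlgorithm.stateAfter, ih]

theorem edgeOverlap_map (U : State n W ≃ₗᵢ[ℂ] State n W) (ψ : (Fin n → Bool) → State n W) :
    edgeOverlap (fun c => U (ψ c)) = edgeOverlap ψ := by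
  simp [edgeOverlap]

theorem norm_edgeOverlap_stateAfter_sub_le (hn : 1 ≤ n) (A : QueryAlgorithm n W)
    (F : (Fin n → Bool) → (Fin n → ℝ) → ℝ)
    (hF : ∀ x c i j, F (flipBit i c) x < F c x → F (flipBit j c) x < F c x → i = j) (k : ℕ) :
    ‖edgeOverlap (fun c => A.stateAfter (F c) k) - n * 2 ^ n‖ ≤ k * (4 * √n * 2 ^ n) := by
  induction k with
  | zero =>
    simp [edgeOverlap, QueryAlgorithm.stateAfter, A.norm_init, mul_comm]
  | succ k ih =>
    have h1 := norm_edgeOverlap_oracle_sub_le hn F hF (fun c => A.stateAfter (F c) k)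
      fun c => norm_stateAfter A (F c) k
    have h2 : edgeOverlap (fun c => A.stateAfter (F c) (k + 1))
        = edgeOverlap (fun c => oracle (F c) (A.stateAfter (F c) k)) :=
      edgeOverlap_map (A.gate k) _
    have h3 := norm_sub_le_norm_sub_add_norm_sub
      (edgeOverlap (fun c => oracle (F c) (A.stateAfter (F c) k)))
      (edgeOverlap (fun c => A.stateAfter (F c) k)) (n * 2 ^ n : ℂ)
    rw [h2]
    push_cast
    linarith

/-- Finding approximate minimizers takes `√n / 10` queries, whatever the precision of the
oracle. -/
theorem sqrt_le_queries (hn : 1 ≤ n) {ρ : ℝ → ℝ} (hρ : Monotone ρ) (A : QueryAlgorithm n W)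
    (hA : ∀ c : Fin n → Bool,
      0.9 ≤ A.outputProb (fun x => ρ (objective c x)) (IsApproxMinimizer c (1 / 3))) :
    √(n : ℝ) / 10 ≤ A.queries := by
  -- A monotone map reflects strict inequalities, so rounding creates no new decreasing edge.
  have hF : ∀ (x : Fin n → ℝ) c i j, ρ (objective (flipBit i c) x) < ρ (objective c x) →
      ρ (objective (flipBit j c) x) < ρ (objective c x) → i = j := fun x c i j hi hj =>
    eq_of_objective_flipBit_lt x c i j (hρ.reflect_lt hi) (hρ.reflect_lt hj)
  have h1 := norm_edgeOverlap_stateAfter_sub_le hn A (fun c x => ρ (objective c x)) hF A.queries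
  have h2 : ‖edgeOverlap (fun c => A.stateAfter (fun x => ρ (objective c x)) A.queries)‖
      ≤ 3 / 5 * (n * 2 ^ n) := by
    refine (norm_sum_le _ _).trans ((Finset.sum_le_sum fun c _ => (norm_sum_le _ _).trans
      (Finset.sum_le_sum fun i _ => norm_inner_le_of_distinguished
        (fun z => IsApproxMinimizer c (1 / 3) (A.output z))
        (fun z => IsApproxMinimizer (flipBit i c) (1 / 3) (A.output z))
        (fun z h => not_isApproxMinimizer_flipBit h) _ _ (norm_stateAfter A _ _)
        (norm_stateAfter A _ _) (hA c) (hA (flipBit i c)))).trans (le_of_eq ?_))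
    simp
    ring
  have h3 : ‖(n * 2 ^ n : ℂ)‖ = n * 2 ^ n := by simp
  have h4 := norm_sub_norm_le (n * 2 ^ n : ℂ)
    (edgeOverlap (fun c => A.stateAfter (fun x => ρ (objective c x)) A.queries))
  rw [norm_sub_rev, h3] at h4
  have hs : 0 < √(n : ℝ) := Real.sqrt_pos.2 (by exact_mod_cast hn)
  have hss : √(n : ℝ) * √n = n := Real.mul_self_sqrt (by positivity)
  -- The required drop is `2 / 5` of `n * 2 ^ n`, at most `4 * √n * 2 ^ n` per query: `(2 / 5) / 4 =
  -- 1 / 10`.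
  have h5 : (2 : ℝ) ^ n * √n * (√n / 10) ≤ 2 ^ n * √n * A.queries := by
    have h6 : (2 : ℝ) ^ n * √n * (√n / 10) = n * 2 ^ n / 10 := by
      linear_combination (2 ^ n / 10 : ℝ) * hss
    rw [h6]
    linarith
  exact le_of_mul_le_mul_left h5 (by positivity)

end Progress

end MaxNormQuery

theorem mainTheorem5 :
    ∃ K : ℝ, 0 < K ∧
      ∀ (n : ℕ), 1 ≤ n →
      ∀ (δ : ℝ), 0 < δ → δ < 0.05 →
      ∀ (ρ : ℝ → ℝ), MaxNormQuery.IsRounding δ ρ →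
      ∀ (W : Type*) (A : MaxNormQuery.QueryAlgorithm n W),
        (∀ c : Fin n → Bool,
          0.9 ≤ A.outputProb (fun x => ρ (MaxNormQuery.objective c x))
            (MaxNormQuery.IsApproxMinimizer c (1 / 3))) →
        K * (√(n : ℝ) / Real.log (1 / δ)) ≤ (A.queries : ℝ) := by
  refine ⟨1 / 10, by norm_num, fun n hn δ hδ hδ' ρ hρ W A hA => ?_⟩
  have h := MaxNormQuery.sqrt_le_queries hn hρ.monotone A hA
  -- `δ < 1 / 20 < 1 / e`.
  have hlog : 1 ≤ Real.log (1 / δ) := by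
    rw [Real.le_log_iff_exp_le (by positivity), le_div_iff₀ hδ]
    nlinarith [Real.exp_one_lt_d9, Real.exp_pos 1]
  have := div_le_self (Real.sqrt_nonneg (n : ℝ)) hlog
  linarith
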